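/- For a finite simple undirected graph $G$, let $\rho(G)$ denote its adjacency spectral radius, that is, the largest eigenvalue of its adjacency matrix. A chord of a cycle $C$ in $G$ is an edge of $G$ joining two non-consecutive vertices of $C$, and a cycle is chorded if it has at least one chord. Let $n \ge 6$ and let $K_{2,n-2}$ be the complete bipartite graph with parts of sizes $2$ and $n-2$. Then $\rho(K_{2,n-2}) = \sqrt{2n-4}$, and for every simple graph $G$ on $n$ vertices with $\rho(G) \ge \rho(K_{2,n-2})$, the graph $G$ contains a chorded cycle if and only if $G \not\cong K_{2,n-2}$. In other words, $G$ contains a chorded cycle unless $G \cong K_{2,n-2}$, and $K_{2,n-2}$ itself contains no chorded cycle. -/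

import Mathlib

namespace SimpleGraph

open Classical in
/-- The adjacency spectral radius of a finite graph: the largest eigenvalue of its adjacency
matrix. The set of eigenvalues is finite, and nonempty if the graph has a vertex. -/
noncomputable def adjSpectralRadius {V : Type*} [Fintype V] (G : SimpleGraph V) : ℝ :=
  sSup (spectrum ℝ (G.adjMatrix ℝ))

open Classical in
/-- The supremum in the definition is attained: it is the largest eigenvalue. -/
theorem isGreatest_adjSpectralRadius {V : Type*} [Fintype V] [Nonempty V] (G : SimpleGraph V) :
    IsGreatest (spectrum ℝ (G.adjMatrix ℝ)) G.adjSpectralRadius := by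
  have hA : (G.adjMatrix ℝ).IsHermitian := by
    ext i j
    simp [SimpleGraph.adjMatrix_apply, G.adj_comm]
  have h := hA.spectrum_real_eq_range_eigenvalues
  have hfin : (spectrum ℝ (G.adjMatrix ℝ)).Finite := by
    rw [h]; exact Set.finite_range _
  have hne : (spectrum ℝ (G.adjMatrix ℝ)).Nonempty := by
    rw [h]; exact Set.range_nonempty _
  exact ⟨hne.csSup_mem hfin, fun x hx => le_csSup hfin.bddAbove hx⟩

/-- `G` contains a chorded cycle: a cycle together with an edge of `G` that joins two vertices of
the cycle and is not an edge of the cycle, i.e. joins two non-consecutive vertices of it. -/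
def HasChordedCycle {V : Type*} (G : SimpleGraph V) : Prop :=
  ∃ (v : V) (c : G.Walk v v), c.IsCycle ∧ ∃ e : Sym2 V, c.IsChord e

end SimpleGraph

/-!
Suppose `G` has no chorded cycle and let `x` be a Perron eigenvector scaled to have maximal entry
`x u = 1`. Counting walks of length two from `u` gives `ρ(G)² = ∑ y, c(y) x(y)`, where `c(y)` is the
number of common neighbours of `u` and `y`. Forbidding chorded cycles bounds the right-hand side:
a neighbour of `u` lies in at most one triangle with `u`, a vertex at distance two with `c(w) ≥ 2`
reaches only the set `T` of neighbours of `u` outside triangles, and those with `c(w) ≥ 3` occupy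
disjoint parts of `T`. Together these give `ρ(G)² ≤ 2n - 4` when `|T| ≥ 2`, while `|T| ≤ 1` would
give `ρ(G)² ≤ n - 1 + ρ(G)`, which is too small for `n ≥ 6`. Equality leaves no triangle at `u` and
a single non-neighbour `w` of `u`, with the same neighbours as `u`; thus `{u, w}` is one part of
`K_{2,n-2}`.
-/

namespace ChordedCycle

open SimpleGraph Matrix
open scoped Finset

section NonnegativeMatrices

theorem mem_spectrum_iff_exists_mulVec_eq_smul {n K : Type*} [Fintype n] [DecidableEq n] [Field K]
    {A : Matrix n n K} {μ : K} : μ ∈ spectrum K A ↔ ∃ x ≠ 0, A *ᵥ x = μ • x := by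
  rw [← Matrix.spectrum_toLin', ← Module.End.hasEigenvalue_iff_mem_spectrum]
  constructor
  · intro h
    obtain ⟨x, hx⟩ := h.exists_hasEigenvector
    exact ⟨x, hx.2, by simpa using hx.apply_eq_smul⟩
  · rintro ⟨x, hx0, hx⟩
    exact Module.End.hasEigenvalue_of_hasEigenvector
      ⟨Module.End.mem_eigenspace_iff.2 (by simpa using hx), hx0⟩

variable {n R : Type*} [Fintype n] [CommRing R] [LinearOrder R] [IsStrictOrderedRing R]
  {A : Matrix n n R} {x : n → R} {μ r : R}

theorem abs_smul_abs_le_mulVec_abs (hA : ∀ i j, 0 ≤ A i j) (hx : A *ᵥ x = μ • x) :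
    |μ| • |x| ≤ A *ᵥ |x| := fun i =>
  calc |μ| * |x i| = |∑ j, A i j * x j| := by
        rw [← abs_mul]
        exact congrArg abs (congrFun hx i).symm
    _ ≤ ∑ j, |A i j * x j| := Finset.abs_sum_le_sum_abs _ _
    _ = ∑ j, A i j * |x j| := by simp only [abs_mul, abs_of_nonneg (hA _ _)]

theorem abs_le_of_pos_vecMul_eq_smul (hA : ∀ i j, 0 ≤ A i j) {z : n → R} (hz : ∀ i, 0 < z i)
    (hzr : z ᵥ* A = r • z) (hx0 : x ≠ 0) (hx : A *ᵥ x = μ • x) : |μ| ≤ r := by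
  have hpos : 0 < z ⬝ᵥ |x| := by
    obtain ⟨i, hi⟩ := Function.ne_iff.1 hx0
    exact Finset.sum_pos' (fun j _ => mul_nonneg (hz j).le (abs_nonneg _))
      ⟨i, Finset.mem_univ i, mul_pos (hz i) (abs_pos.2 hi)⟩
  refine le_of_mul_le_mul_right ?_ hpos
  calc |μ| * (z ⬝ᵥ |x|) = z ⬝ᵥ |μ| • |x| := by rw [dotProduct_smul, smul_eq_mul]
    _ ≤ z ⬝ᵥ A *ᵥ |x| :=
      dotProduct_le_dotProduct_of_nonneg_left (abs_smul_abs_le_mulVec_abs hA hx)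
        fun i => (hz i).le
    _ = r * (z ⬝ᵥ |x|) := by rw [dotProduct_mulVec, hzr, smul_dotProduct, smul_eq_mul]

theorem exists_nonneg_mulVec_eq_smul_of_isGreatest [DecidableEq n] {A : Matrix n n ℝ} {r : ℝ}
    (hA : ∀ i j, 0 ≤ A i j) (hAH : A.IsHermitian) (hr : IsGreatest (spectrum ℝ A) r) :
    ∃ x ≠ 0, 0 ≤ x ∧ A *ᵥ x = r • x := by
  obtain ⟨x, hx0, hx⟩ := mem_spectrum_iff_exists_mulVec_eq_smul.1 hr.1
  set M : Matrix n n ℝ := algebraMap ℝ _ r - A with hM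
  have hMx (y : n → ℝ) : M *ᵥ y = r • y - A *ᵥ y := by
    rw [hM, sub_mulVec, Algebra.algebraMap_eq_smul_one, smul_mulVec, one_mulVec]
  have hpsd : M.PosSemidef := by
    refine posSemidef_iff_isHermitian_and_spectrum_nonneg.2 ⟨?_, ?_⟩
    · rw [hM, Algebra.algebraMap_eq_smul_one]
      exact (isHermitian_one.smul (IsSelfAdjoint.all r)).sub hAH
    · rw [← spectrum.singleton_sub_eq]
      rintro _ ⟨_, rfl, μ, hμ, rfl⟩
      exact sub_nonneg.2 (hr.2 hμ)
  have hle : |x| ⬝ᵥ M *ᵥ |x| ≤ 0 := by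
    refine Finset.sum_nonpos fun i _ => mul_nonpos_of_nonneg_of_nonpos (abs_nonneg _) ?_
    rw [hMx]
    exact sub_nonpos.2 ((mul_le_mul_of_nonneg_right (le_abs_self r) (abs_nonneg _)).trans
      (abs_smul_abs_le_mulVec_abs hA hx i))
  have hzero : M *ᵥ |x| = 0 := (hpsd.dotProduct_mulVec_zero_iff _).1
    (le_antisymm (by simpa using hle) (hpsd.dotProduct_mulVec_nonneg _))
  exact ⟨|x|, fun h => hx0 (funext fun i => abs_eq_zero.1 (congrFun h i)), abs_nonneg x,
    (sub_eq_zero.1 (hMx |x| ▸ hzero)).symm⟩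

end NonnegativeMatrices

section SpectralRadius

variable {V : Type*}

theorem adjMatrix_nonneg (G : SimpleGraph V) [DecidableRel G.Adj] (v w : V) :
    0 ≤ G.adjMatrix ℝ v w := by
  rw [adjMatrix_apply]
  positivity

variable [Fintype V]

theorem isGreatest_spectrum_adjMatrix [Nonempty V] [DecidableEq V] (G : SimpleGraph V)
    [DecidableRel G.Adj] : IsGreatest (spectrum ℝ (G.adjMatrix ℝ)) G.adjSpectralRadius := by
  convert G.isGreatest_adjSpectralRadius

theorem exists_adjMatrix_mulVec_eq_adjSpectralRadius_smul [Nonempty V] (G : SimpleGraph V)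
    [DecidableRel G.Adj] : ∃ (x : V → ℝ) (u : V), (∀ v, 0 ≤ x v) ∧ (∀ v, x v ≤ 1) ∧ x u = 1 ∧
      G.adjMatrix ℝ *ᵥ x = G.adjSpectralRadius • x := by
  classical
  obtain ⟨x, hx0, hnn, hx⟩ := exists_nonneg_mulVec_eq_smul_of_isGreatest (adjMatrix_nonneg G)
    (isHermitian_adjMatrix ℝ G) (isGreatest_spectrum_adjMatrix G)
  obtain ⟨u, hu⟩ := Finite.exists_max x
  have hpos : 0 < x u := by
    obtain ⟨v, hv⟩ := Function.ne_iff.1 hx0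
    exact ((hnn v).lt_of_ne' hv).trans_le (hu v)
  refine ⟨(x u)⁻¹ • x, u, fun v => mul_nonneg (inv_nonneg.2 hpos.le) (hnn v), fun v => ?_,
    inv_mul_cancel₀ hpos.ne', ?_⟩
  · exact (inv_mul_le_one₀ hpos).2 (hu v)
  · rw [mulVec_smul, hx, smul_comm]

theorem adjSpectralRadius_eq_of_pos {G : SimpleGraph V} [Nonempty V] [DecidableRel G.Adj]
    {z : V → ℝ} {r : ℝ} (hz : ∀ v, 0 < z v) (hzr : G.adjMatrix ℝ *ᵥ z = r • z) :
    G.adjSpectralRadius = r := by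
  classical
  refine (isGreatest_spectrum_adjMatrix G).unique
    ⟨mem_spectrum_iff_exists_mulVec_eq_smul.2 ⟨z, ?_, hzr⟩, fun μ hμ => ?_⟩
  · exact Function.ne_iff.2 ⟨Classical.arbitrary V, (hz _).ne'⟩
  · obtain ⟨x, hx0, hx⟩ := mem_spectrum_iff_exists_mulVec_eq_smul.1 hμ
    have hzr' : z ᵥ* G.adjMatrix ℝ = r • z := by
      rw [← mulVec_transpose, transpose_adjMatrix, hzr]
    exact (le_abs_self μ).trans (abs_le_of_pos_vecMul_eq_smul (adjMatrix_nonneg G) hz hzr' hx0 hx)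

theorem adjSpectralRadius_completeBipartiteGraph (α β : Type*) [Fintype α] [Fintype β] [Nonempty α]
    [Nonempty β] : (completeBipartiteGraph α β).adjSpectralRadius =
      √(Fintype.card α * Fintype.card β) := by
  classical
  have hα : (0 : ℝ) < Fintype.card α := mod_cast Fintype.card_pos
  have hβ : (0 : ℝ) < Fintype.card β := mod_cast Fintype.card_pos
  refine adjSpectralRadius_eq_of_pos
    (z := Sum.elim (fun _ => √(Fintype.card β)) (fun _ => √(Fintype.card α))) ?_ ?_
  · rintro (_ | _) <;> simpa using by positivity
  · rw [Real.sqrt_mul hα.le]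
    ext (_ | _)
    · simpa [neighborFinset_eq_filter, Finset.sum_filter, Fintype.sum_sum_type, mul_assoc,
        Real.mul_self_sqrt hβ.le] using mul_comm _ _
    · simp [neighborFinset_eq_filter, Finset.sum_filter, Fintype.sum_sum_type, mul_right_comm,
        Real.mul_self_sqrt hα.le]

end SpectralRadius

section Cycles

variable {V W : Type*} {G : SimpleGraph V} {H : SimpleGraph W}

theorem hasChordedCycle_of_isContained (hGH : G ⊑ H) (hG : G.HasChordedCycle) :
    H.HasChordedCycle := by
  obtain ⟨f⟩ := hGH
  obtain ⟨v, c, hc, ⟨a, b⟩, hab, hne, ha, hb⟩ := hG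
  refine ⟨f v, c.map f.toHom, hc.map f.injective, s(f a, f b), f.toHom.map_adj hab, ?_, ?_, ?_⟩
  · rw [Walk.edges_map]
    exact fun h => hne ((List.mem_map_of_injective (Sym2.map.injective f.injective)).1 h)
  · exact Walk.support_map .. ▸ List.mem_map_of_mem ha
  · exact Walk.support_map .. ▸ List.mem_map_of_mem hb

theorem mem_edges_of_encard_neighborSet_le_two {v r p : V} {c : G.Walk v v}
    (hc : c.IsCycle) (hr : r ∈ c.support) (h2 : (G.neighborSet r).encard ≤ 2)
    (hrp : G.Adj r p) : s(r, p) ∈ c.edges := by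
  have hfin : (G.neighborSet r).Finite := Set.finite_of_encard_le_coe h2
  have heq : c.toSubgraph.neighborSet r = G.neighborSet r :=
    Set.eq_of_subset_of_ncard_le (c.toSubgraph.neighborSet_subset r)
      (by
        rw [hc.ncard_neighborSet_toSubgraph_eq_two hr]
        exact ENat.toNat_le_of_le_natCast h2) hfin
  rw [← Walk.mem_edges_toSubgraph]
  exact heq.ge hrp

theorem not_hasChordedCycle_of_forall_adj_encard_le_two (h : ∀ a b, G.Adj a b →
    (G.neighborSet a).encard ≤ 2 ∨ (G.neighborSet b).encard ≤ 2) : ¬ G.HasChordedCycle := by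
  rintro ⟨v, c, hc, ⟨a, b⟩, hab, hne, ha, hb⟩
  rcases h a b hab with h2 | h2
  · exact hne (mem_edges_of_encard_neighborSet_le_two hc ha h2 hab)
  · have hba : s(b, a) ∈ c.edges := mem_edges_of_encard_neighborSet_le_two hc hb h2 hab.symm
    exact hne (by rwa [Sym2.eq_swap] at hba)

theorem not_hasChordedCycle_completeBipartiteGraph {α : Type*} (hα : ENat.card α ≤ 2) (β : Type*) :
    ¬ (completeBipartiteGraph α β).HasChordedCycle := by
  have hdeg (b : β) : ((completeBipartiteGraph α β).neighborSet (.inr b)).encard ≤ 2 := by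
    have : (completeBipartiteGraph α β).neighborSet (.inr b) = Set.range Sum.inl := by
      ext (_ | _) <;> simp
    rwa [this, ← Set.image_univ, Sum.inl_injective.encard_image, Set.encard_univ]
  refine not_hasChordedCycle_of_forall_adj_encard_le_two ?_
  rintro (a | b) (a' | b') hab
  · simp at hab
  · exact .inr (hdeg b')
  · exact .inl (hdeg b)
  · simp at hab

theorem hasChordedCycle_of_adj_of_isPath {a b : V} {p : G.Walk a b} {q : G.Walk b a}
    (hab : G.Adj a b) (hp : p.IsPath) (hq : q.IsPath) (hp1 : 1 < p.length) (hq1 : 1 < q.length)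
    (hpq : p.support.tail.Disjoint q.support.tail) : G.HasChordedCycle := by
  refine ⟨a, p.append q, hp.isCycle_append hq hpq (.inl hp1), s(a, b), ?_⟩
  rw [Walk.isChord_sym2Mk, Walk.edges_append, List.mem_append, not_or]
  refine ⟨hab, ⟨fun h => ?_, fun h => ?_⟩, Walk.start_mem_support _, by simp⟩
  · exact hp1.ne' (hp.length_eq_one_of_mem_edges h)
  · exact hq1.ne' (hq.length_eq_one_of_mem_edges (Sym2.eq_swap ▸ h))

theorem hasChordedCycle_of_cycle_four {a b c d : V} (hab : G.Adj a b) (hbc : G.Adj b c)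
    (hcd : G.Adj c d) (hda : G.Adj d a) (hac : G.Adj a c) (hbd : b ≠ d) : G.HasChordedCycle :=
  hasChordedCycle_of_adj_of_isPath (p := .cons hab hbc.toWalk) (q := .cons hcd hda.toWalk) hac
    (by simp [hab.ne, hac.ne, hbc.ne]) (by simp [hcd.ne, hac.ne', hda.ne]) (by simp) (by simp)
    (by simp [hab.ne, hcd.ne', hbd.symm, hac.ne])

theorem hasChordedCycle_of_cycle_five {a b c d e : V} (hab : G.Adj a b) (hbc : G.Adj b c)
    (hcd : G.Adj c d) (hde : G.Adj d e) (hea : G.Adj e a) (hac : G.Adj a c) (had : a ≠ d)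
    (hbd : b ≠ d) (hbe : b ≠ e) (hce : c ≠ e) : G.HasChordedCycle :=
  hasChordedCycle_of_adj_of_isPath (p := .cons hab hbc.toWalk)
    (q := .cons hcd (.cons hde hea.toWalk)) hac
    (by simp [hab.ne, hac.ne, hbc.ne])
    (by simp [hcd.ne, hac.ne', hde.ne, hea.ne, hce, had.symm]) (by simp) (by simp)
    (by simp [hab.ne, hcd.ne', hbd.symm, hac.ne, hbe.symm, hce.symm])

theorem hasChordedCycle_of_cycle_six {a b c d e f : V} (hab : G.Adj a b) (hbc : G.Adj b c)
    (hcd : G.Adj c d) (hde : G.Adj d e) (hef : G.Adj e f) (hfa : G.Adj f a) (had : G.Adj a d)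
    (hac : a ≠ c) (hae : a ≠ e) (hbd : b ≠ d) (hbe : b ≠ e) (hbf : b ≠ f) (hce : c ≠ e)
    (hcf : c ≠ f) (hdf : d ≠ f) : G.HasChordedCycle :=
  hasChordedCycle_of_adj_of_isPath (p := .cons hab (.cons hbc hcd.toWalk))
    (q := .cons hde (.cons hef hfa.toWalk)) had
    (by simp [hab.ne, had.ne, hbc.ne, hac, hbd, hcd.ne])
    (by simp [hde.ne, hef.ne, hfa.ne, hdf, had.ne', hae.symm]) (by simp) (by simp)
    (by simp [hab.ne, hac, had.ne, hde.ne', hdf.symm, hbe.symm, hbf.symm, hce.symm, hcf.symm])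

end Cycles

theorem nonempty_iso_completeBipartiteGraph {V α β : Type*} [Fintype V] [Fintype α] [Fintype β]
    {G : SimpleGraph V} [DecidableEq V] {P : Finset V} (hα : #P = Fintype.card α)
    (hβ : #Pᶜ = Fintype.card β)
    (h : ∀ a b, G.Adj a b ↔ ¬ (a ∈ P ↔ b ∈ P)) : Nonempty (G ≃g completeBipartiteGraph α β) := by
  let e₁ : {a // a ∈ P} ≃ α := Fintype.equivOfCardEq (by simpa using hα)
  let e₂ : {a // a ∉ P} ≃ β := Fintype.equivOfCardEq (by
    rw [Fintype.card_subtype_compl, Fintype.card_coe, ← Finset.card_compl, hβ])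
  refine ⟨⟨(Equiv.sumCompl (· ∈ P)).symm.trans (e₁.sumCongr e₂), fun {a b} => ?_⟩⟩
  rw [h]
  by_cases ha : a ∈ P <;> by_cases hb : b ∈ P <;>
    simp [ha, hb, Equiv.sumCompl_symm_apply_of_pos, Equiv.sumCompl_symm_apply_of_neg]

section Codegree

variable {V : Type*} [Fintype V] [DecidableEq V] {G : SimpleGraph V} [DecidableRel G.Adj]
  {u v w : V}

/-- The number of common neighbours of `u` and `v`, equivalently of walks of length two from `u`
to `v`; in particular `codegree G u u` is the degree of `u`. -/
def codegree (G : SimpleGraph V) [DecidableRel G.Adj] (u v : V) : ℕ :=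
  #(G.neighborFinset u ∩ G.neighborFinset v)

/-- The neighbours of `u` that lie on no triangle through `u`. -/
def triangleFreeNeighborFinset (G : SimpleGraph V) [DecidableRel G.Adj] (u : V) : Finset V :=
  (G.neighborFinset u).filter (codegree G u · = 0)

theorem codegree_self (u : V) : codegree G u u = G.degree u := by
  rw [codegree, Finset.inter_self, card_neighborFinset_eq_degree]

theorem exists_common_neighbor_ne (h : 2 ≤ codegree G u v) (a : V) :
    ∃ c, G.Adj u c ∧ G.Adj v c ∧ c ≠ a := by
  obtain ⟨c, hc, hca⟩ := Finset.exists_mem_ne h a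
  rw [Finset.mem_inter, mem_neighborFinset, mem_neighborFinset] at hc
  exact ⟨c, hc.1, hc.2, hca⟩

theorem exists_common_neighbor_ne_ne (h : 3 ≤ codegree G u v) (a b : V) :
    ∃ c, G.Adj u c ∧ G.Adj v c ∧ c ≠ a ∧ c ≠ b := by
  obtain ⟨c, hc, hcab⟩ :=
    Finset.exists_mem_notMem_of_card_lt_card (s := {a, b}) (Finset.card_le_two.trans_lt h)
  rw [Finset.mem_inter, mem_neighborFinset, mem_neighborFinset] at hc
  rw [Finset.mem_insert, Finset.mem_singleton, not_or] at hcab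
  exact ⟨c, hc.1, hc.2, hcab⟩

theorem codegree_eq_zero_iff : codegree G u v = 0 ↔ ∀ a, G.Adj u a → ¬ G.Adj v a := by
  simp only [codegree, Finset.card_eq_zero, ← Finset.disjoint_iff_inter_eq_empty,
    Finset.disjoint_left, mem_neighborFinset]

theorem neighborFinset_subset_of_degree_le_codegree (h : G.degree u ≤ codegree G u v) :
    G.neighborFinset u ⊆ G.neighborFinset v :=
  Finset.inter_eq_left.1 (Finset.eq_of_subset_of_card_le Finset.inter_subset_left h)

theorem sum_eq_add_sum_neighborFinset_add_sum_compl {M : Type*}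
    [AddCommMonoid M] (G : SimpleGraph V) [DecidableRel G.Adj] (u : V) (f : V → M) :
    ∑ v, f v = f u + ∑ v ∈ G.neighborFinset u, f v + ∑ v ∈ Gᶜ.neighborFinset u, f v := by
  have hu : u ∈ (G.neighborFinset u)ᶜ := by simp
  rw [← Finset.sum_add_sum_compl (G.neighborFinset u), ← Finset.add_sum_erase _ _ hu,
    neighborFinset_compl, Finset.sdiff_singleton_eq_erase, add_left_comm, add_assoc]

theorem card_eq_one_add_degree_add_degree_compl (G : SimpleGraph V) [DecidableRel G.Adj] (u : V) :
    Fintype.card V = 1 + G.degree u + Gᶜ.degree u := by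
  simpa using sum_eq_add_sum_neighborFinset_add_sum_compl G u fun _ => (1 : ℕ)

theorem codegree_le_one_of_adj (hG : ¬ G.HasChordedCycle) (huv : G.Adj u v) :
    codegree G u v ≤ 1 := by
  by_contra! h
  obtain ⟨a, hua, hva, -⟩ := exists_common_neighbor_ne h u
  obtain ⟨b, hub, hvb, hba⟩ := exists_common_neighbor_ne h a
  exact hG (hasChordedCycle_of_cycle_four hua hva.symm hvb hub.symm huv hba.symm)

theorem codegree_eq_zero_of_two_le_codegree (hG : ¬ G.HasChordedCycle) (huw : Gᶜ.Adj u w)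
    (h2 : 2 ≤ codegree G u w) {a : V} (hua : G.Adj u a) (hwa : G.Adj w a) :
    codegree G u a = 0 := by
  refine codegree_eq_zero_iff.2 fun b hub hab => hG ?_
  obtain ⟨c, huc, hwc, hca⟩ := exists_common_neighbor_ne h2 a
  obtain rfl | hcb := eq_or_ne c b
  · exact hasChordedCycle_of_cycle_four hua.symm huc hwc.symm hwa hab huw.ne
  · exact hasChordedCycle_of_cycle_five hub hab.symm hwa.symm hwc huc.symm hua huw.ne
      (fun h => huw.2 (h ▸ hub)) hcb.symm hca.symm

theorem codegree_le_one_of_three_le_codegree (hG : ¬ G.HasChordedCycle) {w' b : V}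
    (huw : Gᶜ.Adj u w) (huw' : Gᶜ.Adj u w') (hww' : w ≠ w') (h3 : 3 ≤ codegree G u w)
    (hub : G.Adj u b) (hwb : G.Adj w b) (hwb' : G.Adj w' b) : codegree G u w' ≤ 1 := by
  by_contra! h
  obtain ⟨c, huc, hwc, hcb⟩ := exists_common_neighbor_ne h b
  obtain ⟨d, hud, hwd, hdb, hdc⟩ := exists_common_neighbor_ne_ne h3 b c
  exact hG (hasChordedCycle_of_cycle_six huc hwc.symm hwb' hwb.symm hwd hud.symm hub huw'.ne
    huw.ne hcb (fun h => huw.2 (h ▸ huc)) hdc.symm hww'.symm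
    (fun h => huw'.2 (h ▸ hud)) hdb.symm)

theorem sum_codegree_add_card_triangleFree_le (hG : ¬ G.HasChordedCycle) (u : V) :
    ∑ v ∈ G.neighborFinset u, codegree G u v + #(triangleFreeNeighborFinset G u) ≤
      G.degree u := by
  rw [triangleFreeNeighborFinset, Finset.card_filter, ← Finset.sum_add_distrib,
    ← card_neighborFinset_eq_degree, Finset.card_eq_sum_ones]
  refine Finset.sum_le_sum fun v hv => ?_
  have := codegree_le_one_of_adj hG ((mem_neighborFinset _ _ _).1 hv)
  split_ifs <;> omega

theorem inter_neighborFinset_subset_triangleFree (hG : ¬ G.HasChordedCycle)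
    (huw : Gᶜ.Adj u w) (h2 : 2 ≤ codegree G u w) :
    G.neighborFinset u ∩ G.neighborFinset w ⊆ triangleFreeNeighborFinset G u := by
  intro a ha
  obtain ⟨hua, hwa⟩ := Finset.mem_inter.1 ha
  exact Finset.mem_filter.2 ⟨hua, codegree_eq_zero_of_two_le_codegree hG huw h2
    ((mem_neighborFinset _ _ _).1 hua) ((mem_neighborFinset _ _ _).1 hwa)⟩

theorem sum_codegree_filter_three_le (hG : ¬ G.HasChordedCycle) (u : V) :
    ∑ w ∈ Gᶜ.neighborFinset u with 3 ≤ codegree G u w, codegree G u w ≤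
      #(triangleFreeNeighborFinset G u) := by
  set K := {w ∈ Gᶜ.neighborFinset u | 3 ≤ codegree G u w} with hKdef
  have hK {w : V} (hw : w ∈ K) : Gᶜ.Adj u w ∧ 3 ≤ codegree G u w := by
    simpa only [hKdef, Finset.mem_filter, mem_neighborFinset] using hw
  have hdisj : (K : Set V).PairwiseDisjoint fun w => G.neighborFinset u ∩ G.neighborFinset w := by
    refine fun w hw w' hw' hne => Finset.disjoint_left.2 fun b hb hb' => ?_
    rw [Finset.mem_inter, mem_neighborFinset, mem_neighborFinset] at hb hb'
    have h1 : codegree G u w' ≤ 1 := codegree_le_one_of_three_le_codegree hG (hK hw).1 (hK hw').1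
      hne (hK hw).2 hb.1 hb.2 hb'.2
    have h3 := (hK hw').2
    omega
  calc ∑ w ∈ K, codegree G u w
      = #(K.biUnion fun w => G.neighborFinset u ∩ G.neighborFinset w) :=
        (Finset.card_biUnion hdisj).symm
    _ ≤ #(triangleFreeNeighborFinset G u) :=
        Finset.card_le_card (Finset.biUnion_subset.2 fun w hw =>
          inter_neighborFinset_subset_triangleFree hG (hK hw).1 (Nat.le_of_succ_le (hK hw).2))

/- The truncated subtraction makes only the vertices with codegree at least three count. -/
theorem sum_codegree_sub_two_add_two_le (hG : ¬ G.HasChordedCycle)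
    (hT : 2 ≤ #(triangleFreeNeighborFinset G u)) :
    ∑ w ∈ Gᶜ.neighborFinset u, (codegree G u w - 2) + 2 ≤ #(triangleFreeNeighborFinset G u) := by
  have hK := sum_codegree_filter_three_le hG u
  rw [← Finset.sum_filter_of_ne (p := (3 ≤ codegree G u ·)) fun w _ hw => by omega]
  obtain hempty | hne := Finset.eq_empty_or_nonempty {w ∈ Gᶜ.neighborFinset u | 3 ≤ codegree G u w}
  · simpa [hempty] using hT
  · have hsum : ∑ w ∈ Gᶜ.neighborFinset u with 3 ≤ codegree G u w, (codegree G u w - 2) +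
        ∑ w ∈ Gᶜ.neighborFinset u with 3 ≤ codegree G u w, 2 =
        ∑ w ∈ Gᶜ.neighborFinset u with 3 ≤ codegree G u w, codegree G u w := by
      rw [← Finset.sum_add_distrib]
      exact Finset.sum_congr rfl fun w hw => by
        have := (Finset.mem_filter.1 hw).2
        omega
    have hcard := hne.card_pos
    rw [Finset.sum_const, smul_eq_mul] at hsum
    omega

theorem sum_codegree_sub_two_add_sum_min (G : SimpleGraph V) [DecidableRel G.Adj] (u : V) :
    ∑ w ∈ Gᶜ.neighborFinset u, (codegree G u w - 2) +
      ∑ w ∈ Gᶜ.neighborFinset u, min (codegree G u w) 2 =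
      ∑ w ∈ Gᶜ.neighborFinset u, codegree G u w := by
  rw [← Finset.sum_add_distrib]
  exact Finset.sum_congr rfl fun w _ => by omega

theorem sum_min_codegree_two_le (G : SimpleGraph V) [DecidableRel G.Adj] (u : V) :
    ∑ w ∈ Gᶜ.neighborFinset u, min (codegree G u w) 2 ≤ 2 * Gᶜ.degree u := by
  rw [mul_comm, ← card_neighborFinset_eq_degree, ← smul_eq_mul]
  exact Finset.sum_le_card_nsmul _ _ 2 fun w _ => min_le_right _ _

theorem sum_codegree_add_two_le (hG : ¬ G.HasChordedCycle)
    (hT : 2 ≤ #(triangleFreeNeighborFinset G u)) :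
    ∑ w ∈ Gᶜ.neighborFinset u, codegree G u w + 2 ≤
      2 * Gᶜ.degree u + #(triangleFreeNeighborFinset G u) := by
  have := sum_codegree_sub_two_add_two_le hG hT
  have := sum_codegree_sub_two_add_sum_min G u
  have := sum_min_codegree_two_le G u
  omega

theorem two_le_codegree_of_le_sum (hG : ¬ G.HasChordedCycle)
    (hT : 2 ≤ #(triangleFreeNeighborFinset G u))
    (hsum : 2 * Gᶜ.degree u + #(triangleFreeNeighborFinset G u) ≤
      ∑ w ∈ Gᶜ.neighborFinset u, codegree G u w + 2) (huw : Gᶜ.Adj u w) :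
    2 ≤ codegree G u w := by
  have hexcess := sum_codegree_sub_two_add_two_le hG hT
  have hsplit := sum_codegree_sub_two_add_sum_min G u
  have hmin : ∑ w ∈ Gᶜ.neighborFinset u, min (codegree G u w) 2 =
      ∑ w ∈ Gᶜ.neighborFinset u, 2 := by
    have := sum_min_codegree_two_le G u
    rw [Finset.sum_const, card_neighborFinset_eq_degree, smul_eq_mul]
    omega
  exact min_eq_right_iff.1 ((Finset.sum_eq_sum_iff_of_le fun w _ => min_le_right _ _).1 hmin w
    ((mem_neighborFinset _ _ _).2 huw))

theorem exists_compl_adj_degree_le_codegree (hG : ¬ G.HasChordedCycle) (hd : 3 ≤ G.degree u)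
    (hsum : 2 * Gᶜ.degree u + G.degree u ≤ ∑ w ∈ Gᶜ.neighborFinset u, codegree G u w + 2) :
    ∃ w, Gᶜ.Adj u w ∧ G.degree u ≤ codegree G u w := by
  set K := {w ∈ Gᶜ.neighborFinset u | 3 ≤ codegree G u w}
  set L := {w ∈ Gᶜ.neighborFinset u | ¬ 3 ≤ codegree G u w}
  have hKsum : ∑ w ∈ K, codegree G u w ≤ G.degree u :=
    (sum_codegree_filter_three_le hG u).trans
      (by have := sum_codegree_add_card_triangleFree_le hG u; omega)
  have hLsum : ∑ w ∈ L, codegree G u w ≤ #L * 2 :=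
    Finset.sum_le_card_nsmul _ _ 2 fun w hw => by
      have := (Finset.mem_filter.1 hw).2
      omega
  have hadd : ∑ w ∈ K, codegree G u w + ∑ w ∈ L, codegree G u w =
      ∑ w ∈ Gᶜ.neighborFinset u, codegree G u w := Finset.sum_filter_add_sum_filter_not ..
  have hcard : #K + #L = Gᶜ.degree u := Finset.card_filter_add_card_filter_not ..
  have hKpos : #K ≠ 0 := fun h => by
    rw [Finset.card_eq_zero.1 h, Finset.sum_empty] at hadd
    omega
  obtain ⟨w, hw⟩ : ∃ w, K = {w} := Finset.card_eq_one.1 (by omega)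
  have hwK : w ∈ K := hw ▸ Finset.mem_singleton_self w
  refine ⟨w, (mem_neighborFinset _ _ _).1 (Finset.mem_filter.1 hwK).1, ?_⟩
  rw [hw, Finset.sum_singleton] at hadd
  rw [hw, Finset.card_singleton] at hcard
  omega

theorem degree_le_two_of_codegree_ne_zero (hG : ¬ G.HasChordedCycle)
    (hfar : ∀ w, Gᶜ.Adj u w → 2 ≤ codegree G u w) {v : V} (huv : G.Adj u v)
    (hv : codegree G u v ≠ 0) : G.degree v ≤ 2 := by
  have hsub : G.neighborFinset v ⊆ insert u (G.neighborFinset u ∩ G.neighborFinset v) := by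
    intro y hvy
    by_contra hy
    rw [Finset.mem_insert, Finset.mem_inter, not_or, not_and_or, or_iff_left (not_not_intro hvy),
      mem_neighborFinset] at hy
    have huy : Gᶜ.Adj u y := ⟨Ne.symm hy.1, hy.2⟩
    exact hv (codegree_eq_zero_of_two_le_codegree hG huy (hfar y huy) huv
      ((mem_neighborFinset _ _ _).1 hvy).symm)
  calc G.degree v ≤ codegree G u v + 1 :=
        (Finset.card_le_card hsub).trans (Finset.card_insert_le ..)
    _ ≤ 2 := Nat.succ_le_succ (codegree_le_one_of_adj hG huv)

theorem eq_of_compl_adj_of_degree_le_codegree (hG : ¬ G.HasChordedCycle) (hd : 3 ≤ G.degree u)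
    (huw : Gᶜ.Adj u w) (hw : G.degree u ≤ codegree G u w) {y : V} (huy : Gᶜ.Adj u y)
    (hy : 2 ≤ codegree G u y) : y = w := by
  by_contra hyw
  obtain ⟨b, hub, hyb, -⟩ := exists_common_neighbor_ne hy u
  have hwb : G.Adj w b := by
    have hsub := neighborFinset_subset_of_degree_le_codegree hw
    exact (mem_neighborFinset _ _ _).1 (hsub ((mem_neighborFinset _ _ _).2 hub))
  exact hy.not_gt (Nat.lt_succ_of_le (codegree_le_one_of_three_le_codegree hG huw huy
    (Ne.symm hyw) (hd.trans hw) hub hwb hyb))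

theorem adj_iff_of_unique_compl_adj (huw : Gᶜ.Adj u w)
    (hsub : G.neighborFinset u ⊆ G.neighborFinset w) (huniq : ∀ v, Gᶜ.Adj u v → v = w)
    (hfree : ∀ v, G.Adj u v → codegree G u v = 0) (a b : V) :
    G.Adj a b ↔ ¬ (a ∈ ({u, w} : Finset V) ↔ b ∈ ({u, w} : Finset V)) := by
  have hadj (c : V) (hc : c ∉ ({u, w} : Finset V)) : G.Adj u c ∧ G.Adj w c := by
    rw [Finset.mem_insert, Finset.mem_singleton, not_or] at hc
    have huc : G.Adj u c := by
      by_contra h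
      exact hc.2 (huniq c ⟨Ne.symm hc.1, h⟩)
    exact ⟨huc, (mem_neighborFinset _ _ _).1 (hsub ((mem_neighborFinset _ _ _).2 huc))⟩
  have hin (c d : V) (hc : c ∈ ({u, w} : Finset V)) (hd : d ∈ ({u, w} : Finset V)) :
      ¬ G.Adj c d := by
    have := huw.2
    have := G.adj_comm u w
    grind [SimpleGraph.irrefl]
  have hcross (c d : V) (hc : c ∈ ({u, w} : Finset V)) (hd : d ∉ ({u, w} : Finset V)) :
      G.Adj c d := by
    rw [Finset.mem_insert, Finset.mem_singleton] at hc
    rcases hc with rfl | rfl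
    exacts [(hadj d hd).1, (hadj d hd).2]
  have hout (c d : V) (hc : c ∉ ({u, w} : Finset V)) (hd : d ∉ ({u, w} : Finset V)) :
      ¬ G.Adj c d :=
    codegree_eq_zero_iff.1 (hfree c (hadj c hc).1) d (hadj d hd).1
  by_cases ha : a ∈ ({u, w} : Finset V) <;> by_cases hb : b ∈ ({u, w} : Finset V)
  · simp only [hin a b ha hb, ha, hb, not_true]
  · simp only [hcross a b ha hb, ha, hb, iff_false, not_true, not_false_eq_true]
  · simp only [(hcross b a hb ha).symm, ha, hb, iff_true, not_false_eq_true]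
  · simp only [hout a b ha hb, ha, hb, not_true]

theorem exists_card_eq_two_forall_adj_iff (hG : ¬ G.HasChordedCycle) (hd : 3 ≤ G.degree u)
    (hsum : 2 * Gᶜ.degree u + G.degree u ≤ ∑ w ∈ Gᶜ.neighborFinset u, codegree G u w + 2)
    (hfar : ∀ w, Gᶜ.Adj u w → 2 ≤ codegree G u w)
    (hfree : ∀ v, G.Adj u v → codegree G u v = 0) :
    ∃ P : Finset V, #P = 2 ∧ ∀ a b, G.Adj a b ↔ ¬ (a ∈ P ↔ b ∈ P) := by
  obtain ⟨w, huw, hw⟩ := exists_compl_adj_degree_le_codegree hG hd hsum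
  exact ⟨{u, w}, Finset.card_pair huw.ne, adj_iff_of_unique_compl_adj huw
    (neighborFinset_subset_of_degree_le_codegree hw)
    (fun y huy => eq_of_compl_adj_of_degree_le_codegree hG hd huw hw huy (hfar y huy)) hfree⟩

end Codegree

section Eigenvector

variable {V : Type*} [Fintype V] {G : SimpleGraph V} [DecidableRel G.Adj] {x : V → ℝ} {r : ℝ}
  {u : V}

theorem sum_neighborFinset_eq_mul {R : Type*} [NonAssocSemiring R] {x : V → R} {r : R}
    (hx : G.adjMatrix R *ᵥ x = r • x) (u : V) : ∑ v ∈ G.neighborFinset u, x v = r * x u := by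
  rw [← adjMatrix_mulVec_apply, hx, Pi.smul_apply, smul_eq_mul]

theorem eigenvalue_le_degree (hx : G.adjMatrix ℝ *ᵥ x = r • x) (hx1 : ∀ v, x v ≤ 1)
    (hxu : x u = 1) : r ≤ G.degree u := by
  have hsum := sum_neighborFinset_eq_mul hx u
  rw [hxu, mul_one] at hsum
  simpa [← hsum] using Finset.sum_le_card_nsmul (G.neighborFinset u) x 1 fun v _ => hx1 v

variable [DecidableEq V]

theorem adjMatrix_mul_self_apply (R : Type*) [NonAssocSemiring R] (G : SimpleGraph V)
    [DecidableRel G.Adj] (u v : V) : (G.adjMatrix R * G.adjMatrix R) u v = codegree G u v := by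
  simp only [adjMatrix_mul_apply, adjMatrix_apply, Finset.sum_boole, codegree]
  congr 2
  ext w
  simp [G.adj_comm]

theorem sum_codegree_mul_eq_sq_mul {R : Type*} [CommSemiring R] {x : V → R} {r : R}
    (hx : G.adjMatrix R *ᵥ x = r • x) (u : V) : ∑ v, codegree G u v * x v = r ^ 2 * x u :=
  calc ∑ v, codegree G u v * x v = ((G.adjMatrix R * G.adjMatrix R) *ᵥ x) u := by
        simp only [mulVec, dotProduct, adjMatrix_mul_self_apply]
    _ = r ^ 2 * x u := by
        rw [← mulVec_mulVec, hx, mulVec_smul, hx, smul_smul, ← sq, Pi.smul_apply, smul_eq_mul]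

theorem sq_eq_degree_add_sum_codegree_mul (hx : G.adjMatrix ℝ *ᵥ x = r • x) (hxu : x u = 1) :
    r ^ 2 = G.degree u + ∑ v ∈ G.neighborFinset u, codegree G u v * x v +
      ∑ w ∈ Gᶜ.neighborFinset u, codegree G u w * x w := by
  have h := sum_codegree_mul_eq_sq_mul hx u
  rwa [sum_eq_add_sum_neighborFinset_add_sum_compl G u, hxu, mul_one, mul_one,
    codegree_self, eq_comm] at h

theorem sum_natCast_mul_le {ι : Type*} {x : ι → ℝ} (hx1 : ∀ i, x i ≤ 1) (s : Finset ι)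
    (f : ι → ℕ) : ∑ i ∈ s, f i * x i ≤ (∑ i ∈ s, f i : ℕ) := by
  rw [Nat.cast_sum]
  exact Finset.sum_le_sum fun i _ => mul_le_of_le_one_right (Nat.cast_nonneg _) (hx1 i)

theorem two_le_card_triangleFree (hG : ¬ G.HasChordedCycle) (hn : 6 ≤ Fintype.card V)
    (hx : G.adjMatrix ℝ *ᵥ x = r • x) (hx0 : ∀ v, 0 ≤ x v) (hx1 : ∀ v, x v ≤ 1) (hxu : x u = 1)
    (hr : 2 * (Fintype.card V : ℝ) - 4 ≤ r ^ 2) : 2 ≤ #(triangleFreeNeighborFinset G u) := by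
  by_contra hT
  have hfar (w : V) (huw : Gᶜ.Adj u w) : codegree G u w ≤ 1 := by
    by_contra! h2
    exact hT (h2.trans_le (Finset.card_le_card
      (inter_neighborFinset_subset_triangleFree hG huw h2)))
  have hN : ∑ v ∈ G.neighborFinset u, codegree G u v * x v ≤ r :=
    calc ∑ v ∈ G.neighborFinset u, codegree G u v * x v ≤ ∑ v ∈ G.neighborFinset u, x v :=
          Finset.sum_le_sum fun v hv => mul_le_of_le_one_left (hx0 v)
            (mod_cast codegree_le_one_of_adj hG ((mem_neighborFinset _ _ _).1 hv))
      _ = r := by rw [sum_neighborFinset_eq_mul hx, hxu, mul_one]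
  have hW : ∑ w ∈ Gᶜ.neighborFinset u, codegree G u w * x w ≤ Gᶜ.degree u := by
    rw [← card_neighborFinset_eq_degree, Finset.card_eq_sum_ones]
    refine (sum_natCast_mul_le hx1 _ _).trans (mod_cast Finset.sum_le_sum fun w hw => ?_)
    exact hfar w ((mem_neighborFinset _ _ _).1 hw)
  have hcard : (Fintype.card V : ℝ) = 1 + G.degree u + Gᶜ.degree u :=
    mod_cast card_eq_one_add_degree_add_degree_compl G u
  have hsq := sq_eq_degree_add_sum_codegree_mul hx hxu
  have hn' : (6 : ℝ) ≤ Fintype.card V := mod_cast hn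
  have hle : (Fintype.card V : ℝ) - 3 ≤ r := by linarith
  nlinarith [hle]

theorem le_sum_codegree_and_eq_one_of_le_sq (hG : ¬ G.HasChordedCycle)
    (hT : 2 ≤ #(triangleFreeNeighborFinset G u)) (hx : G.adjMatrix ℝ *ᵥ x = r • x)
    (hx1 : ∀ v, x v ≤ 1) (hxu : x u = 1) (hr : 2 * (Fintype.card V : ℝ) - 4 ≤ r ^ 2) :
    2 * Gᶜ.degree u + #(triangleFreeNeighborFinset G u) ≤
        ∑ w ∈ Gᶜ.neighborFinset u, codegree G u w + 2 ∧
      ∀ v, G.Adj u v → codegree G u v ≠ 0 → x v = 1 := by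
  have hcard : (Fintype.card V : ℝ) = 1 + G.degree u + Gᶜ.degree u :=
    mod_cast card_eq_one_add_degree_add_degree_compl G u
  have hsq := sq_eq_degree_add_sum_codegree_mul hx hxu
  have hNx := sum_natCast_mul_le hx1 (G.neighborFinset u) (codegree G u)
  have hWx := sum_natCast_mul_le hx1 (Gᶜ.neighborFinset u) (codegree G u)
  have hN : ((∑ v ∈ G.neighborFinset u, codegree G u v : ℕ) : ℝ) +
      #(triangleFreeNeighborFinset G u) ≤ G.degree u :=
    mod_cast sum_codegree_add_card_triangleFree_le hG u
  have hW : ((∑ w ∈ Gᶜ.neighborFinset u, codegree G u w : ℕ) : ℝ) + 2 ≤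
      2 * Gᶜ.degree u + #(triangleFreeNeighborFinset G u) :=
    mod_cast sum_codegree_add_two_le hG hT
  constructor
  · have hle : 2 * (Gᶜ.degree u : ℝ) + #(triangleFreeNeighborFinset G u) ≤
        (∑ w ∈ Gᶜ.neighborFinset u, codegree G u w : ℕ) + 2 := by linarith
    exact mod_cast hle
  · intro v hv h0
    have heq : ∑ v ∈ G.neighborFinset u, (codegree G u v : ℝ) * x v =
        ∑ v ∈ G.neighborFinset u, (codegree G u v : ℝ) := by
      rw [← Nat.cast_sum]
      linarith
    have hv' := (Finset.sum_eq_sum_iff_of_le fun v _ =>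
      mul_le_of_le_one_right (Nat.cast_nonneg (codegree G u v)) (hx1 v)).1 heq v
        ((mem_neighborFinset _ _ _).2 hv)
    exact (mul_eq_left₀ (Nat.cast_ne_zero.2 h0)).1 hv'

end Eigenvector

theorem nonempty_iso_of_not_hasChordedCycle {V : Type*} [Fintype V] {G : SimpleGraph V}
    (hG : ¬ G.HasChordedCycle) (hn : 6 ≤ Fintype.card V)
    (hρ : √(2 * (Fintype.card V : ℝ) - 4) ≤ G.adjSpectralRadius) :
    Nonempty (G ≃g completeBipartiteGraph (Fin 2) (Fin (Fintype.card V - 2))) := by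
  classical
  have : Nonempty V := Fintype.card_pos_iff.1 (by omega)
  obtain ⟨x, u, hx0, hx1, hxu, hx⟩ := exists_adjMatrix_mulVec_eq_adjSpectralRadius_smul G
  obtain ⟨hr0, hr⟩ := Real.sqrt_le_iff.1 hρ
  set r := G.adjSpectralRadius
  have hr2 : 2 < r := by
    have : (6 : ℝ) ≤ Fintype.card V := mod_cast hn
    nlinarith
  have hT := two_le_card_triangleFree hG hn hx hx0 hx1 hxu hr
  obtain ⟨hsum, hx1'⟩ := le_sum_codegree_and_eq_one_of_le_sq hG hT hx hx1 hxu hr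
  have hfar (w : V) (huw : Gᶜ.Adj u w) : 2 ≤ codegree G u w :=
    two_le_codegree_of_le_sum hG hT hsum huw
  have hfree (v : V) (huv : G.Adj u v) : codegree G u v = 0 := by
    by_contra hv
    have hle := eigenvalue_le_degree hx hx1 (hx1' v huv hv)
    have hd : (G.degree v : ℝ) ≤ 2 := mod_cast degree_le_two_of_codegree_ne_zero hG hfar huv hv
    linarith
  have hTN : triangleFreeNeighborFinset G u = G.neighborFinset u :=
    Finset.filter_true_of_mem fun v hv => hfree v ((mem_neighborFinset _ _ _).1 hv)
  have hd : 3 ≤ G.degree u := by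
    exact_mod_cast hr2.trans_le (eigenvalue_le_degree hx hx1 hxu)
  obtain ⟨P, hP, hadj⟩ := exists_card_eq_two_forall_adj_iff hG hd
    (by rwa [hTN, card_neighborFinset_eq_degree] at hsum) hfar hfree
  exact nonempty_iso_completeBipartiteGraph (by rw [hP, Fintype.card_fin])
    (by rw [Finset.card_compl, hP, Fintype.card_fin]) hadj

end ChordedCycle

theorem theorem1 {V : Type*} [Fintype V] (G : SimpleGraph V) (n : ℕ) (hn : 6 ≤ n)
    (hV : Fintype.card V = n) :
    (completeBipartiteGraph (Fin 2) (Fin (n - 2))).adjSpectralRadius = √(2 * (n : ℝ) - 4) ∧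
      ((completeBipartiteGraph (Fin 2) (Fin (n - 2))).adjSpectralRadius ≤ G.adjSpectralRadius →
        (G.HasChordedCycle ↔
          ¬ Nonempty (G ≃g completeBipartiteGraph (Fin 2) (Fin (n - 2))))) := by
  subst hV
  have : Nonempty (Fin (Fintype.card V - 2)) := ⟨⟨0, by omega⟩⟩
  have hρ : (completeBipartiteGraph (Fin 2) (Fin (Fintype.card V - 2))).adjSpectralRadius =
      √(2 * (Fintype.card V : ℝ) - 4) := by
    rw [ChordedCycle.adjSpectralRadius_completeBipartiteGraph, Fintype.card_fin, Fintype.card_fin,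
      Nat.cast_sub (by omega), Nat.cast_ofNat]
    ring_nf
  refine ⟨hρ, fun hle => ⟨?_, fun hiso => ?_⟩⟩
  · rintro hG ⟨φ⟩
    exact ChordedCycle.not_hasChordedCycle_completeBipartiteGraph (by simp) _
      (ChordedCycle.hasChordedCycle_of_isContained φ.isContained hG)
  · by_contra hG
    exact hiso (ChordedCycle.nonempty_iso_of_not_hasChordedCycle hG hn (hρ ▸ hle))
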